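/- Let $\mathcal H=\mathcal H_1\otimes\dots\otimes\mathcal H_k$, where each $\mathcal H_j$ is a finite-dimensional complex Hilbert space, and let $\psi\in\mathcal H$ be a unit vector. For $n\ge 1$ regard $\mathcal H^{\otimes n}=\mathcal H_1^{\otimes n}\otimes\dots\otimes\mathcal H_k^{\otimes n}$ as a $k$-partite space and $\psi^{\otimes n}$ as a $k$-partite unit vector. For a $k$-partite unit vector $\varphi$ let $\operatorname{Tr}_j|\varphi\rangle\langle\varphi|$ be the partial trace over the $j$-th factor. For a state $\rho$ with eigenvalues $(p_i)$, counted with multiplicity, let $$H_\alpha(\rho)=\frac{1}{1-\alpha}\log_2\sum_i p_i^{\alpha}\quad(0<\alpha<1),\qquad H_0(\rho)=\log_2\operatorname{rank}\rho,\qquad H_1(\rho)=H(\rho)=-\sum_i p_i\log_2 p_i .$$ Then for all weights $\theta_j\ge 0$ and all $\alpha_j\in[0,1]$, $j=1,\dots,k$, $$\lim_{\epsilon\to 0^+}\limsup_{n\to\infty}\frac1n\inf_{\substack{\varphi\in\mathcal H^{\otimes n},\ \|\varphi\|=1\\ |\langle\varphi|\psi^{\otimes n}\rangle|^2\ge 1-\epsilon}}\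 \sum_{j=1}^k\theta_j H_{\alpha_j}\!\left(\operatorname{Tr}_j|\varphi\rangle\langle\varphi|\right)=\sum_{j=1}^k\theta_j H\!\left(\operatorname{Tr}_j|\psi\rangle\langle\psi|\right),$$ where the limit on the left exists. In particular, for every $j\in\{1,\dots,k\}$ and every $\alpha\in[0,1]$, $$\lim_{\epsilon\to 0^+}\limsup_{n\to\infty}\frac1n\inf_{\substack{\varphi\in\mathcal H^{\otimes n},\ \|\varphi\|=1\\ |\langle\varphi|\psi^{\otimes n}\rangle|^2\ge 1-\epsilon}} H_{\alpha}\!\left(\operatorname{Tr}_j|\varphi\rangle\langle\varphi|\right)=H\!\left(\operatorname{Tr}_j|\psi\rangle\langle\psi|\right).$$ -/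

import Mathlib

open Filter Topology

namespace MultipartiteAEP

/-- The Shannon entropy (base 2) of a weight function on a finite set. -/
noncomputable def shannonEntropy {S : Type*} [Fintype S] (P : S → ℝ) : ℝ :=
  -∑ x, P x * Real.logb 2 (P x)

/-- The Rényi entropy (base 2) of order `a`; the orders `0` and `1` are the limiting cases, the
max entropy (logarithm of the size of the support) and the Shannon entropy. -/
noncomputable def renyiEntropy {S : Type*} [Fintype S] (a : ℝ) (P : S → ℝ) : ℝ :=
  if a = 0 then Real.logb 2 (Nat.card {x : S // 0 < P x})
  else if a = 1 then shannonEntropy P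
  else 1 / (1 - a) * Real.logb 2 (∑ x, P x ^ a)

section Multipartite

variable {k : ℕ} {X : Fin k → Type*} [∀ j, Fintype (X j)]

/-- The `k`-partite Hilbert space `ℂ^{X 0} ⊗ ⋯ ⊗ ℂ^{X (k-1)}`, whose vectors are given by their
coordinates in the product basis. The inner product is the standard one. -/
abbrev Vec {k : ℕ} (X : Fin k → Type*) [∀ j, Fintype (X j)] : Type _ :=
  EuclideanSpace ℂ (∀ j, X j)

/-- The rank one operator `|φ⟩⟨φ|`. -/
noncomputable def pureState (φ : Vec X) : Matrix (∀ j, X j) (∀ j, X j) ℂ :=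
  Matrix.of fun x y => φ x * star (φ y)

/-- The partial trace over the `j`-th tensor factor: an operator on the tensor product of the
remaining factors. -/
noncomputable def partialTrace (j : Fin k) (ρ : Matrix (∀ i, X i) (∀ i, X i) ℂ) :
    Matrix (∀ i : {i // i ≠ j}, X i) (∀ i : {i // i ≠ j}, X i) ℂ :=
  Matrix.of fun x y =>
    ∑ s : X j, ρ ((Equiv.piSplitAt j X).symm (s, x)) ((Equiv.piSplitAt j X).symm (s, y))

theorem isHermitian_partialTrace_pureState (j : Fin k) (φ : Vec X) :
    (partialTrace j (pureState φ)).IsHermitian := by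
  ext x y
  simp [partialTrace, pureState, Matrix.conjTranspose_apply, mul_comm]

/-- The Rényi entropy of order `a` of the state `Tr_j |φ⟩⟨φ|`, i.e. the Rényi entropy of its
eigenvalues (listed with multiplicity). -/
noncomputable def marginalRenyi [∀ j, DecidableEq (X j)] (a : ℝ) (j : Fin k) (φ : Vec X) : ℝ :=
  renyiEntropy a (isHermitian_partialTrace_pureState j φ).eigenvalues

/-- The von Neumann entropy of the state `Tr_j |φ⟩⟨φ|`. -/
noncomputable def marginalEntropy [∀ j, DecidableEq (X j)] (j : Fin k) (φ : Vec X) : ℝ :=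
  shannonEntropy (isHermitian_partialTrace_pureState j φ).eigenvalues

/-- The tensor power `φ^{⊗n}` as a `k`-partite vector: the `n` copies of the `j`-th factor are
grouped together, so that the `j`-th local space is `(ℂ^{X j})^{⊗n} = ℂ^{Fin n → X j}`. -/
noncomputable def tensorPower (φ : Vec X) (n : ℕ) : Vec (fun j => Fin n → X j) :=
  WithLp.toLp 2 fun x => ∏ t, φ fun j => x j t

/-- The smoothing `E^ε(ψ)`: the infimum of `E(φ)` over the unit vectors `φ` with
`|⟨φ|ψ⟩|² ≥ 1 - ε`. -/
noncomputable def smoothed (E : Vec X → ℝ) (ε : ℝ) (ψ : Vec X) : ℝ :=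
  sInf (E '' {φ : Vec X | ‖φ‖ = 1 ∧ 1 - ε ≤ ‖inner ℂ φ ψ‖ ^ 2})

end Multipartite

end MultipartiteAEP

/-!
The Rényi entropies of order in `[0, 1]` lie between the von Neumann entropy (order `1`) and the
logarithm of the rank (order `0`). It therefore suffices to find, for large `n`, one unit vector
close to `ψ^{⊗n}` whose `j`-th reduced state has rank at most `2 ^ (n (H_j + δ))` for every `j`,
where `H_j` is the entropy of the `j`-th reduced state of `ψ`, and to show that no unit vector
sufficiently close to `ψ^{⊗n}` has a `j`-th reduced state of entropy less than `n (H_j - δ)`.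

For the spectrum, the partial trace over the `j`-th factor may be replaced by the reduced state on
the `j`-th factor (`sum_eigenvalues_partialTrace`). The reduced state of `ψ^{⊗n}` is the `n`-th tensor
power of that of `ψ`, so its eigenvalues are the product probabilities `∏ t, p (x t)`, and a Chernoff
bound (`tendsto_sum_prod_of_mean_neg`) shows that most of its weight sits on eigenvalues close to
`2 ^ (-n H_j)`.

* Upper bound (`exists_vec_rank_le`, `eventually_exists_vec`). Expand `ψ^{⊗n}` in the product of the
  local eigenbases and keep only the components whose `j`-th label is typical for every `j`. By the
  union bound little weight is lost, and the `j`-th rank is at most the number of typical labels.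
* Lower bound (`sub_marginalEntropy_le_of_close`, `eventually_le_marginalEntropy`). If the `j`-th
  entropy of `φ` were below `n (H_j - δ)`, by Markov's inequality a subspace of dimension at most
  `2 ^ (n (H_j - δ / 2))` would carry a fixed fraction of the weight of `φ`, hence of `ψ^{⊗n}`. But a
  subspace of this dimension carries vanishing weight of `ψ^{⊗n}`, whose typical eigenvalues are at
  most `2 ^ (-n (H_j - δ / 4))`.

The statement for a single factor is the case of a weight concentrated on that factor.
-/

namespace MultipartiteAEP

/-! ### Classical entropies and the asymptotic equipartition property -/

section Classical

variable {S : Type*} [Fintype S]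

/-- The moment generating function of a variable of negative mean decreases at `0`. -/
theorem exists_sum_mul_exp_lt_one {p g : S → ℝ} (hp1 : ∑ x, p x = 1)
    (hg : ∑ x, p x * g x < 0) : ∃ s : ℝ, 0 < s ∧ ∑ x, p x * Real.exp (s * g x) < 1 := by
  have hd : HasDerivAt (fun s : ℝ => ∑ x, p x * Real.exp (s * g x)) (∑ x, p x * g x) 0 := by
    refine HasDerivAt.fun_sum fun x _ => ?_
    have h := (((hasDerivAt_id (0 : ℝ)).mul_const (g x)).exp).const_mul (p x)
    simpa using h
  have h0 : (fun s : ℝ => ∑ x, p x * Real.exp (s * g x)) 0 = 1 := by simpa using hp1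
  have hlt : ∀ᶠ s in 𝓝[>] (0 : ℝ), slope (fun s : ℝ => ∑ x, p x * Real.exp (s * g x)) 0 s < 0 :=
    ((hasDerivAt_iff_tendsto_slope.1 hd).mono_left
      (nhdsWithin_mono _ fun s (hs : 0 < s) => hs.ne')).eventually_lt_const hg
  obtain ⟨s, hs, hs0⟩ := (hlt.and self_mem_nhdsWithin).exists
  have hs0 : 0 < s := hs0
  refine ⟨s, hs0, ?_⟩
  rw [slope_def_field, sub_zero, div_lt_iff₀ hs0, zero_mul, sub_lt_zero] at hs
  exact hs.trans_eq h0

/-- Chernoff bound: if the mean of `g` is negative, the probability that the sum of `n` independent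
copies of `g` is nonnegative tends to zero. -/
theorem tendsto_sum_prod_of_mean_neg {p g : S → ℝ} (hp : ∀ x, 0 ≤ p x) (hp1 : ∑ x, p x = 1)
    (hg : ∑ x, p x * g x < 0) :
    Tendsto (fun n : ℕ => ∑ x : Fin n → S with 0 ≤ ∑ t, g (x t), ∏ t, p (x t)) atTop (𝓝 0) := by
  obtain ⟨s, hs, h1⟩ := exists_sum_mul_exp_lt_one hp1 hg
  have h0 : 0 ≤ ∑ x, p x * Real.exp (s * g x) :=
    Finset.sum_nonneg fun x _ => mul_nonneg (hp x) (Real.exp_pos _).le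
  refine squeeze_zero (fun n => Finset.sum_nonneg fun x _ => Finset.prod_nonneg fun t _ => hp _)
    (fun n => ?_) (tendsto_pow_atTop_nhds_zero_of_lt_one h0 h1)
  rw [Fintype.sum_pow]
  refine (Finset.sum_le_sum fun x hx => ?_).trans (Finset.sum_le_sum_of_subset_of_nonneg
    (Finset.filter_subset _ _) fun x _ _ => Finset.prod_nonneg fun t _ =>
      mul_nonneg (hp _) (Real.exp_pos _).le)
  rw [Finset.prod_mul_distrib, ← Real.exp_sum, ← Finset.mul_sum]
  exact le_mul_of_one_le_right (Finset.prod_nonneg fun t _ => hp _)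
    (Real.one_le_exp (mul_nonneg hs.le (Finset.mem_filter.1 hx).2))

theorem logb_prod_eq_sum {S : Type*} {n : ℕ} {p : S → ℝ} {x : Fin n → S} (hx : ∏ t, p (x t) ≠ 0) :
    Real.logb 2 (∏ t, p (x t)) = ∑ t, Real.logb 2 (p (x t)) :=
  Real.logb_prod _ (fun t => p (x t)) fun t _ h => hx (Finset.prod_eq_zero (Finset.mem_univ t) h)

/-- Words whose probability exceeds `2 ^ (-n (H - δ))` are rare. -/
theorem tendsto_sum_prod_of_large {p : S → ℝ} (hp : ∀ x, 0 ≤ p x) (hp1 : ∑ x, p x = 1)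
    {δ : ℝ} (hδ : 0 < δ) :
    Tendsto (fun n : ℕ => ∑ x : Fin n → S with
      (2 : ℝ) ^ (-(n * (shannonEntropy p - δ))) < ∏ t, p (x t), ∏ t, p (x t)) atTop (𝓝 0) := by
  have hg : ∑ x, p x * (Real.logb 2 (p x) + (shannonEntropy p - δ)) < 0 := by
    simp only [mul_add, Finset.sum_add_distrib, ← Finset.sum_mul, hp1]
    simp only [shannonEntropy]; linarith
  refine squeeze_zero (fun n => Finset.sum_nonneg fun x _ => Finset.prod_nonneg fun t _ => hp _)
    (fun n => Finset.sum_le_sum_of_subset_of_nonneg (fun x hx => ?_) fun x _ _ =>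
      Finset.prod_nonneg fun t _ => hp _) (tendsto_sum_prod_of_mean_neg hp hp1 hg)
  rw [Finset.mem_filter] at hx ⊢
  refine ⟨hx.1, ?_⟩
  have hpos : 0 < ∏ t, p (x t) := (Real.rpow_pos_of_pos two_pos _).trans hx.2
  have h := (Real.le_logb_iff_rpow_le one_lt_two hpos).2 hx.2.le
  rw [logb_prod_eq_sum hpos.ne'] at h
  simp only [Finset.sum_add_distrib, Finset.sum_const, Finset.card_univ, Fintype.card_fin,
    nsmul_eq_mul]
  linarith

/-- Words whose probability is at most `2 ^ (-n (H + δ))` carry vanishing total weight. -/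
theorem tendsto_sum_prod_of_small {p : S → ℝ} (hp : ∀ x, 0 ≤ p x) (hp1 : ∑ x, p x = 1)
    {δ : ℝ} (hδ : 0 < δ) :
    Tendsto (fun n : ℕ => ∑ x : Fin n → S with
      ∏ t, p (x t) ≤ (2 : ℝ) ^ (-(n * (shannonEntropy p + δ))), ∏ t, p (x t)) atTop (𝓝 0) := by
  have hg : ∑ x, p x * (-Real.logb 2 (p x) - (shannonEntropy p + δ)) < 0 := by
    simp only [mul_sub, Finset.sum_sub_distrib, ← Finset.sum_mul, hp1]
    simp only [shannonEntropy, mul_neg, Finset.sum_neg_distrib]; linarith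
  refine squeeze_zero (fun n => Finset.sum_nonneg fun x _ => Finset.prod_nonneg fun t _ => hp _)
    (fun n => ?_) (tendsto_sum_prod_of_mean_neg hp hp1 hg)
  -- Words of probability zero need not lie in the exceptional set, but contribute nothing.
  rw [← Finset.sum_filter_ne_zero]
  refine Finset.sum_le_sum_of_subset_of_nonneg (fun x hx => ?_) fun x _ _ =>
      Finset.prod_nonneg fun t _ => hp _
  simp only [Finset.mem_filter, Finset.mem_univ, true_and] at hx ⊢
  have hpos : 0 < ∏ t, p (x t) := lt_of_le_of_ne (Finset.prod_nonneg fun t _ => hp _) hx.2.symm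
  have h := (Real.logb_le_iff_le_rpow one_lt_two hpos).2 hx.1
  rw [logb_prod_eq_sum hpos.ne'] at h
  simp only [Finset.sum_sub_distrib, Finset.sum_neg_distrib, Finset.sum_const, Finset.card_univ,
    Fintype.card_fin, nsmul_eq_mul]
  linarith

/-- At most `2 ^ R` outcomes can have probability at least `2 ^ (-R)`. -/
theorem card_le_of_forall_le {p : S → ℝ} (hp : ∀ x, 0 ≤ p x) (hp1 : ∑ x, p x = 1) {R : ℝ}
    {T : Finset S} (hT : ∀ x ∈ T, (2 : ℝ) ^ (-R) ≤ p x) : (T.card : ℝ) ≤ 2 ^ R := by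
  have h : (T.card : ℝ) * 2 ^ (-R) ≤ 1 := by
    rw [← nsmul_eq_mul, ← hp1]
    exact (Finset.card_nsmul_le_sum _ _ _ hT).trans
      (Finset.sum_le_sum_of_subset_of_nonneg (Finset.subset_univ _) fun x _ _ => hp x)
  rw [Real.rpow_neg two_pos.le, ← div_eq_mul_inv,
    div_le_one (Real.rpow_pos_of_pos two_pos _)] at h
  exact h

theorem shannonEntropy_nonneg {p : S → ℝ} (hp : ∀ x, 0 ≤ p x) (hp1 : ∑ x, p x = 1) :
    0 ≤ shannonEntropy p := by
  rw [shannonEntropy, neg_nonneg]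
  refine Finset.sum_nonpos fun x _ => mul_nonpos_of_nonneg_of_nonpos (hp x) ?_
  refine Real.logb_nonpos one_lt_two (hp x) ?_
  rw [← hp1]
  exact Finset.single_le_sum (fun y _ => hp y) (Finset.mem_univ x)

/-- Jensen's inequality for the logarithm, restricted to the support of `p`. -/
theorem mul_shannonEntropy_le {p : S → ℝ} (hp : ∀ x, 0 ≤ p x) (hp1 : ∑ x, p x = 1) (a : ℝ) :
    (1 - a) * shannonEntropy p ≤ Real.logb 2 (∑ x with 0 < p x, p x ^ a) := by
  have hlog : ConcaveOn ℝ (Set.Ioi 0) Real.log := strictConcaveOn_log_Ioi.concaveOn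
  have hsum : ∑ x with 0 < p x, p x = 1 := by
    rw [← hp1]
    refine Finset.sum_subset (Finset.filter_subset _ _) fun x _ hx => ?_
    simp only [Finset.mem_filter, Finset.mem_univ, true_and, not_lt] at hx
    exact le_antisymm hx (hp x)
  have h := hlog.le_map_sum (t := Finset.univ.filter fun x => 0 < p x) (w := p)
    (p := fun x => p x ^ (a - 1)) (fun x _ => hp x) hsum
    (fun x hx => Real.rpow_pos_of_pos (Finset.mem_filter.1 hx).2 _)
  have e1 : ∑ x with 0 < p x, p x • p x ^ (a - 1) = ∑ x with 0 < p x, p x ^ a := by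
    refine Finset.sum_congr rfl fun x hx => ?_
    have hx := (Finset.mem_filter.1 hx).2
    rw [Real.rpow_sub_one hx.ne', smul_eq_mul, mul_div_cancel₀ _ hx.ne']
  have e2 : ∑ x with 0 < p x, p x • Real.log (p x ^ (a - 1))
      = (a - 1) * ∑ x, p x * Real.log (p x) := by
    have e : ∑ x with 0 < p x, p x * Real.log (p x) = ∑ x, p x * Real.log (p x) := by
      refine Finset.sum_subset (Finset.filter_subset _ _) fun x _ hx => ?_
      simp only [Finset.mem_filter, Finset.mem_univ, true_and, not_lt] at hx
      simp [le_antisymm hx (hp x)]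
    rw [← e, Finset.mul_sum]
    refine Finset.sum_congr rfl fun x hx => ?_
    rw [Real.log_rpow (Finset.mem_filter.1 hx).2, smul_eq_mul]; ring
  rw [e1, e2] at h
  have h2 : 0 < Real.log 2 := Real.log_pos one_lt_two
  have e3 : (1 - a) * shannonEntropy p = ((a - 1) * ∑ x, p x * Real.log (p x)) / Real.log 2 := by
    simp only [shannonEntropy, Real.logb, ← mul_div_assoc, ← Finset.sum_div]; ring
  rw [e3, Real.logb]
  exact div_le_div_of_nonneg_right h h2.le

theorem natCard_support (p : S → ℝ) :
    Nat.card {x : S // 0 < p x} = (Finset.univ.filter fun x => 0 < p x).card := by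
  rw [Nat.card_eq_fintype_card, Fintype.card_subtype]

theorem sum_filter_rpow {p : S → ℝ} (hp : ∀ x, 0 ≤ p x) {a : ℝ} (ha : a ≠ 0) :
    ∑ x with 0 < p x, p x ^ a = ∑ x, p x ^ a := by
  refine Finset.sum_subset (Finset.filter_subset _ _) fun x _ hx => ?_
  simp only [Finset.mem_filter, Finset.mem_univ, true_and, not_lt] at hx
  rw [le_antisymm hx (hp x), Real.zero_rpow ha]

/-- The Shannon entropy is the smallest of the Rényi entropies of order at most `1`. -/
theorem shannonEntropy_le_renyiEntropy {p : S → ℝ} (hp : ∀ x, 0 ≤ p x) (hp1 : ∑ x, p x = 1)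
    {a : ℝ} (ha : a ≤ 1) : shannonEntropy p ≤ renyiEntropy a p := by
  have h := mul_shannonEntropy_le hp hp1 a
  rw [renyiEntropy]
  split_ifs with h0 h1
  · subst h0
    rw [natCard_support]
    simpa using h
  · exact le_rfl
  · rw [sum_filter_rpow hp h0] at h
    have h2 : 0 < 1 - a := sub_pos.2 (lt_of_le_of_ne ha h1)
    rw [one_div, ← div_eq_inv_mul, le_div_iff₀ h2]
    linarith

theorem renyiEntropy_nonneg {p : S → ℝ} (hp : ∀ x, 0 ≤ p x) (hp1 : ∑ x, p x = 1)
    {a : ℝ} (ha : a ≤ 1) : 0 ≤ renyiEntropy a p :=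
  (shannonEntropy_nonneg hp hp1).trans (shannonEntropy_le_renyiEntropy hp hp1 ha)

theorem renyiEntropy_le_renyiEntropy_zero {p : S → ℝ} (hp : ∀ x, 0 ≤ p x) (hp1 : ∑ x, p x = 1)
    {a : ℝ} (ha0 : 0 ≤ a) (ha : a ≤ 1) : renyiEntropy a p ≤ renyiEntropy 0 p := by
  by_cases h0 : a = 0
  · rw [h0]
  by_cases h1 : a = 1
  · subst h1
    simpa [renyiEntropy] using shannonEntropy_le_renyiEntropy hp hp1 (a := 0) zero_le_one
  have hapos : 0 < a := lt_of_le_of_ne ha0 (Ne.symm h0)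
  have h2 : 0 < 1 - a := sub_pos.2 (lt_of_le_of_ne ha h1)
  have hsum : ∑ x with 0 < p x, p x = 1 := by
    simpa [hp1] using sum_filter_rpow hp (a := 1) one_ne_zero
  set T : Finset S := Finset.univ.filter fun x => 0 < p x with hT
  have hne : T.Nonempty := Finset.nonempty_of_sum_ne_zero (by rw [hsum]; exact one_ne_zero)
  have hpos : 0 < ∑ x ∈ T, p x ^ a :=
    Finset.sum_pos (fun x hx => Real.rpow_pos_of_pos (Finset.mem_filter.1 hx).2 _) hne
  have hc : (0 : ℝ) < T.card := by exact_mod_cast hne.card_pos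
  -- The power mean inequality with exponent `1 / a`.
  have hH := Real.rpow_sum_le_const_mul_sum_rpow (f := fun x => p x ^ a) T
    (p := 1 / a) ((one_le_div hapos).2 ha)
  have e : ∑ x ∈ T, |p x ^ a| ^ (1 / a) = 1 := by
    refine (Finset.sum_congr rfl fun x _ => ?_).trans hsum
    rw [abs_of_nonneg (Real.rpow_nonneg (hp x) _), ← Real.rpow_mul (hp x),
      mul_one_div_cancel h0, Real.rpow_one]
  have e' : ∑ x ∈ T, |p x ^ a| = ∑ x ∈ T, p x ^ a :=
    Finset.sum_congr rfl fun x _ => abs_of_nonneg (Real.rpow_nonneg (hp x) _)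
  rw [e, e', mul_one] at hH
  have hl := Real.logb_le_logb_of_le one_lt_two (Real.rpow_pos_of_pos hpos _) hH
  rw [Real.logb_rpow_eq_mul_logb_of_pos hpos, Real.logb_rpow_eq_mul_logb_of_pos hc] at hl
  rw [renyiEntropy, if_neg h0, if_neg h1, renyiEntropy, if_pos rfl, natCard_support,
    ← sum_filter_rpow hp h0, one_div, ← div_eq_inv_mul, div_le_iff₀ h2]
  have := mul_le_mul_of_nonneg_left hl hapos.le
  have e3 : a * (1 / a * Real.logb 2 (∑ x ∈ T, p x ^ a)) = Real.logb 2 (∑ x ∈ T, p x ^ a) := by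
    field_simp
  have e4 : a * ((1 / a - 1) * Real.logb 2 (T.card : ℝ)) = Real.logb 2 (T.card : ℝ) * (1 - a) := by
    field_simp
  rwa [e3, e4] at this

/-- Markov's inequality for the random variable `-log p`: if the entropy is below `R`, a definite
fraction of the weight sits on outcomes of probability at least `2 ^ (-R)`. -/
theorem sub_shannonEntropy_le {p : S → ℝ} (hp : ∀ x, 0 ≤ p x) (hp1 : ∑ x, p x = 1)
    {R : ℝ} : R - shannonEntropy p ≤ R * ∑ x with (2 : ℝ) ^ (-R) ≤ p x, p x := by
  have hle : ∀ x, p x ≤ 1 := fun x => by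
    rw [← hp1]; exact Finset.single_le_sum (fun y _ => hp y) (Finset.mem_univ x)
  have hs := Finset.sum_filter_add_sum_filter_not Finset.univ (fun x => (2 : ℝ) ^ (-R) ≤ p x) p
  have h : R * ∑ x with ¬ (2 : ℝ) ^ (-R) ≤ p x, p x ≤ shannonEntropy p := by
    rw [shannonEntropy, ← Finset.sum_neg_distrib, Finset.mul_sum]
    refine (Finset.sum_le_sum fun x hx => ?_).trans (Finset.sum_le_sum_of_subset_of_nonneg
      (Finset.filter_subset _ _) fun x _ _ => ?_)
    · have hx := not_le.1 (Finset.mem_filter.1 hx).2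
      rcases (hp x).eq_or_lt with h0 | h0
      · simp [← h0]
      · have := (Real.logb_lt_iff_lt_rpow one_lt_two h0).2 hx
        nlinarith
    · have := Real.logb_nonpos one_lt_two (hp x) (hle x)
      nlinarith [hp x]
  rw [hp1] at hs
  have : R * ∑ x with ¬ (2 : ℝ) ^ (-R) ≤ p x, p x
    = R - R * ∑ x with (2 : ℝ) ^ (-R) ≤ p x, p x := by
    rw [← eq_sub_iff_add_eq'] at hs
    rw [hs]; ring
  linarith

end Classical

/-! ### Product vectors and product bases -/

section TensorBasis

variable {ι : Type*} [Fintype ι] [DecidableEq ι] {Z : ι → Type*} [∀ i, Fintype (Z i)]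

/-- The product vector `⊗ᵢ v i`. -/
noncomputable def tensorVec (v : ∀ i, EuclideanSpace ℂ (Z i)) : EuclideanSpace ℂ (∀ i, Z i) :=
  WithLp.toLp 2 fun z => ∏ i, v i (z i)

theorem inner_tensorVec (u v : ∀ i, EuclideanSpace ℂ (Z i)) :
    inner ℂ (tensorVec u) (tensorVec v) = ∏ i, inner ℂ (u i) (v i) := by
  simp only [tensorVec, PiLp.inner_apply, Fintype.prod_sum]
  refine Finset.sum_congr rfl fun z _ => ?_
  simp [Finset.prod_mul_distrib]

theorem orthonormal_tensorVec (b : ∀ i, OrthonormalBasis (Z i) ℂ (EuclideanSpace ℂ (Z i))) :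
    Orthonormal ℂ fun x : ∀ i, Z i => tensorVec fun i => b i (x i) := by
  refine ⟨fun x => ?_, fun x y hxy => ?_⟩
  · have h := inner_tensorVec (fun i => b i (x i)) fun i => b i (x i)
    simp only [inner_self_eq_norm_sq_to_K, OrthonormalBasis.norm_eq_one] at h
    have h' : ‖tensorVec fun i => b i (x i)‖ ^ 2 = 1 := by
      have h2 := congrArg Complex.re h
      simp only [Complex.coe_algebraMap, ← Complex.ofReal_pow, Complex.ofReal_re, one_pow,
        Complex.ofReal_one, Finset.prod_const_one, Complex.one_re] at h2
      exact h2
    exact (pow_eq_one_iff_of_nonneg (norm_nonneg _) two_ne_zero).1 h'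
  · obtain ⟨i, hi⟩ := Function.ne_iff.1 hxy
    rw [inner_tensorVec]
    exact Finset.prod_eq_zero (Finset.mem_univ i) ((b i).orthonormal.2 hi)

/-- The orthonormal basis of product vectors formed from orthonormal bases of the factors. -/
noncomputable def tensorBasis (b : ∀ i, OrthonormalBasis (Z i) ℂ (EuclideanSpace ℂ (Z i))) :
    OrthonormalBasis (∀ i, Z i) ℂ (EuclideanSpace ℂ (∀ i, Z i)) :=
  OrthonormalBasis.mk (orthonormal_tensorVec b)
    ((orthonormal_tensorVec b).linearIndependent.span_eq_top_of_card_eq_finrank' (by simp)).ge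

@[simp] theorem tensorBasis_apply (b : ∀ i, OrthonormalBasis (Z i) ℂ (EuclideanSpace ℂ (Z i)))
    (x : ∀ i, Z i) : tensorBasis b x = tensorVec fun i => b i (x i) := by
  rw [tensorBasis, OrthonormalBasis.coe_mk]

end TensorBasis

/-! ### Nonzero eigenvalues of products of matrices -/

section Spectrum

/-- `A * B` and `B * A` have the same nonzero eigenvalues, hence the same sums of any function of
the eigenvalues that vanishes at `0`. -/
theorem sum_eigenvalues_eq_of_charpoly {m n : Type*} [Fintype m] [Fintype n] [DecidableEq m]
    [DecidableEq n] {P : Matrix m m ℂ} {Q : Matrix n n ℂ} (hP : P.IsHermitian)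
    (hQ : Q.IsHermitian) {a b : ℕ}
    (h : Polynomial.X ^ a * P.charpoly = Polynomial.X ^ b * Q.charpoly) (f : ℝ → ℝ) (hf : f 0 = 0) :
    ∑ i, f (hP.eigenvalues i) = ∑ i, f (hQ.eigenvalues i) := by
  have hr := congrArg Polynomial.roots h
  rw [Polynomial.roots_mul (mul_ne_zero (pow_ne_zero _ Polynomial.X_ne_zero)
      (Matrix.charpoly_monic P).ne_zero),
    Polynomial.roots_mul (mul_ne_zero (pow_ne_zero _ Polynomial.X_ne_zero)
      (Matrix.charpoly_monic Q).ne_zero), Polynomial.roots_X_pow, Polynomial.roots_X_pow,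
    hP.roots_charpoly_eq_eigenvalues, hQ.roots_charpoly_eq_eigenvalues] at hr
  have hs := congrArg (fun M : Multiset ℂ => (M.map fun z => f z.re).sum) hr
  simpa [Multiset.nsmul_singleton, hf] using hs

end Spectrum

/-! ### Reduced states on a single factor -/

section Local

variable {k : ℕ} {X : Fin k → Type*} [∀ j, Fintype (X j)]

/-- The vector of the `j`-th factor obtained from a multipartite vector by fixing the coordinates
`y` of all the other factors. -/
noncomputable def slice (j : Fin k) (y : ∀ i : {i // i ≠ j}, X i) :
    Vec X →ₗ[ℂ] EuclideanSpace ℂ (X j) where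
  toFun φ := WithLp.toLp 2 fun s => φ ((Equiv.piSplitAt j X).symm (s, y))
  map_add' _ _ := rfl
  map_smul' _ _ := rfl

theorem slice_apply (j : Fin k) (y : ∀ i : {i // i ≠ j}, X i) (φ : Vec X) (s : X j) :
    slice j y φ s = φ ((Equiv.piSplitAt j X).symm (s, y)) := rfl

/-- The matrix of `φ` for the bipartition of the factors into `j` and the rest; its columns are the
slices of `φ`. -/
noncomputable def bipartiteMatrix (j : Fin k) (φ : Vec X) :
    Matrix (X j) (∀ i : {i // i ≠ j}, X i) ℂ :=
  Matrix.of fun s y => slice j y φ s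

/-- The reduced state of `φ` on the `j`-th factor. -/
noncomputable def localState (j : Fin k) (φ : Vec X) : Matrix (X j) (X j) ℂ :=
  bipartiteMatrix j φ * (bipartiteMatrix j φ).conjTranspose

theorem isHermitian_localState (j : Fin k) (φ : Vec X) : (localState j φ).IsHermitian :=
  Matrix.isHermitian_mul_conjTranspose_self _

theorem partialTrace_pureState (j : Fin k) (φ : Vec X) :
    partialTrace j (pureState φ) =
      (bipartiteMatrix j φ).transpose * (bipartiteMatrix j φ).transpose.conjTranspose := by
  ext x y
  simp [partialTrace, pureState, bipartiteMatrix, Matrix.mul_apply, slice_apply]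

theorem sum_slice (j : Fin k) (f : (∀ i, X i) → ℝ) :
    ∑ y, ∑ s, f ((Equiv.piSplitAt j X).symm (s, y)) = ∑ x, f x := by
  rw [Finset.sum_comm, ← Fintype.sum_prod_type', (Equiv.piSplitAt j X).symm.sum_comp]

theorem sum_norm_sq_slice (j : Fin k) (φ : Vec X) : ∑ y, ‖slice j y φ‖ ^ 2 = ‖φ‖ ^ 2 := by
  simp only [EuclideanSpace.norm_sq_eq, slice_apply]
  exact sum_slice j fun x => ‖φ x‖ ^ 2

theorem eigenvalues_localState_nonneg [∀ j, DecidableEq (X j)] (j : Fin k) (φ : Vec X) (s : X j) :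
    0 ≤ (isHermitian_localState j φ).eigenvalues s :=
  open scoped ComplexOrder in
  (Matrix.posSemidef_self_mul_conjTranspose (bipartiteMatrix j φ)).eigenvalues_nonneg s

theorem eigenvalues_partialTrace_nonneg [∀ j, DecidableEq (X j)] (j : Fin k) (φ : Vec X)
    (y : ∀ i : {i // i ≠ j}, X i) :
    0 ≤ (isHermitian_partialTrace_pureState j φ).eigenvalues y := by
  open scoped ComplexOrder in
  refine Matrix.PosSemidef.eigenvalues_nonneg ?_ y
  rw [partialTrace_pureState]
  exact Matrix.posSemidef_self_mul_conjTranspose _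

/-- The two reduced states of a vector for a bipartition have the same nonzero eigenvalues. -/
theorem sum_eigenvalues_partialTrace [∀ j, DecidableEq (X j)] (j : Fin k) (φ : Vec X) (f : ℝ → ℝ)
    (hf : f 0 = 0) :
    ∑ y, f ((isHermitian_partialTrace_pureState j φ).eigenvalues y) =
      ∑ s, f ((isHermitian_localState j φ).eigenvalues s) := by
  refine sum_eigenvalues_eq_of_charpoly _ _ (a := Fintype.card (X j))
    (b := Fintype.card (∀ i : {i // i ≠ j}, X i)) ?_ f hf
  rw [partialTrace_pureState, Matrix.charpoly_mul_comm', localState,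
    ← Matrix.charpoly_transpose (bipartiteMatrix j φ * _), Matrix.transpose_mul]
  rfl

theorem sum_eigenvalues_localState [∀ j, DecidableEq (X j)] (j : Fin k) {φ : Vec X}
    (hφ : ‖φ‖ = 1) : ∑ s, (isHermitian_localState j φ).eigenvalues s = 1 := by
  have h := (isHermitian_localState j φ).trace_eq_sum_eigenvalues
  have h2 : (localState j φ).trace = ((‖φ‖ ^ 2 : ℝ) : ℂ) := by
    rw [← sum_norm_sq_slice j φ, Finset.sum_congr rfl fun y _ => EuclideanSpace.norm_sq_eq _,
      Finset.sum_comm]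
    simp [Matrix.trace, localState, Matrix.mul_apply, bipartiteMatrix, Complex.mul_conj,
      Complex.normSq_eq_norm_sq]
  rw [h2, hφ] at h
  have h3 := congrArg Complex.re h
  simpa using h3.symm

theorem sum_eigenvalues_partialTrace_eq_one [∀ j, DecidableEq (X j)] (j : Fin k) {φ : Vec X}
    (hφ : ‖φ‖ = 1) : ∑ y, (isHermitian_partialTrace_pureState j φ).eigenvalues y = 1 :=
  (sum_eigenvalues_partialTrace j φ (fun x => x) rfl).trans (sum_eigenvalues_localState j hφ)

theorem marginalEntropy_eq [∀ j, DecidableEq (X j)] (j : Fin k) (φ : Vec X) :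
    marginalEntropy j φ = shannonEntropy (isHermitian_localState j φ).eigenvalues := by
  rw [marginalEntropy, shannonEntropy, shannonEntropy,
    sum_eigenvalues_partialTrace j φ (fun x => x * Real.logb 2 x) (by simp)]

/-- The expectation `⟨v, ρ v⟩` in the reduced state `ρ` of `φ` on the `j`-th factor, written as the
squared norm of the contraction of `φ` with `v` (see `localWeight_eq_inner`). -/
noncomputable def localWeight (j : Fin k) (φ : Vec X) (v : EuclideanSpace ℂ (X j)) : ℝ :=
  ∑ y, ‖inner ℂ v (slice j y φ)‖ ^ 2

theorem localWeight_nonneg (j : Fin k) (φ : Vec X) (v : EuclideanSpace ℂ (X j)) :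
    0 ≤ localWeight j φ v := Finset.sum_nonneg fun _ _ => sq_nonneg _

theorem sum_localWeight (j : Fin k) (φ : Vec X)
    (b : OrthonormalBasis (X j) ℂ (EuclideanSpace ℂ (X j))) :
    ∑ s, localWeight j φ (b s) = ‖φ‖ ^ 2 := by
  simp only [localWeight]
  rw [Finset.sum_comm, ← sum_norm_sq_slice j]
  exact Finset.sum_congr rfl fun y _ => b.sum_sq_norm_inner_right _

theorem localWeight_smul (j : Fin k) (c : ℂ) (φ : Vec X) (v : EuclideanSpace ℂ (X j)) :
    localWeight j (c • φ) v = ‖c‖ ^ 2 * localWeight j φ v := by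
  simp [localWeight, mul_pow, Finset.mul_sum]

theorem localWeight_add_le (j : Fin k) (φ χ : Vec X) (v : EuclideanSpace ℂ (X j)) :
    localWeight j (φ + χ) v ≤ 2 * localWeight j φ v + 2 * localWeight j χ v := by
  simp only [localWeight, Finset.mul_sum, ← Finset.sum_add_distrib]
  refine Finset.sum_le_sum fun y _ => ?_
  rw [map_add, inner_add_right]
  have h := norm_add_le (inner ℂ v (slice j y φ)) (inner ℂ v (slice j y χ))
  nlinarith [sq_nonneg (‖inner ℂ v (slice j y φ)‖ - ‖inner ℂ v (slice j y χ)‖),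
    norm_nonneg (inner ℂ v (slice j y φ) + inner ℂ v (slice j y χ))]

theorem localWeight_eq_inner (j : Fin k) (φ : Vec X) (v : EuclideanSpace ℂ (X j)) :
    (localWeight j φ v : ℂ) =
      inner ℂ v (WithLp.toLp 2 ((localState j φ).mulVec v) : EuclideanSpace ℂ (X j)) := by
  have h : ∀ y, inner ℂ v (slice j y φ) = star ((bipartiteMatrix j φ).conjTranspose.mulVec v y) := by
    intro y
    simp [PiLp.inner_apply, Matrix.mulVec, dotProduct, bipartiteMatrix]
  rw [EuclideanSpace.inner_eq_star_dotProduct, localState, ← Matrix.mulVec_mulVec,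
    dotProduct_comm, Matrix.dotProduct_mulVec, ← Matrix.conjTranspose_conjTranspose
      (bipartiteMatrix j φ), ← Matrix.star_mulVec, Matrix.conjTranspose_conjTranspose]
  simp only [localWeight, h, norm_star]
  simp only [dotProduct, Complex.ofReal_sum, Pi.star_apply, RCLike.star_def, Complex.conj_mul',
    Complex.ofReal_pow]

/-- The expectation of `|v⟩⟨v|` in terms of an orthonormal eigenbasis `b` of the reduced state. -/
theorem localWeight_eq_sum (j : Fin k) (φ : Vec X)
    (b : OrthonormalBasis (X j) ℂ (EuclideanSpace ℂ (X j))) (p : X j → ℝ)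
    (hb : ∀ s, (localState j φ).mulVec (b s) = (p s : ℂ) • ⇑(b s))
    (v : EuclideanSpace ℂ (X j)) :
    localWeight j φ v = ∑ s, p s * ‖inner ℂ (b s) v‖ ^ 2 := by
  have hH : ∀ s, inner ℂ (b s)
      (WithLp.toLp 2 ((localState j φ).mulVec v) : EuclideanSpace ℂ (X j))
        = p s * inner ℂ (b s) v := by
    intro s
    rw [EuclideanSpace.inner_eq_star_dotProduct, EuclideanSpace.inner_eq_star_dotProduct,
      dotProduct_comm, Matrix.dotProduct_mulVec]
    have h1 := congrArg star (hb s)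
    rw [Matrix.star_mulVec, (isHermitian_localState j φ).eq, star_smul] at h1
    rw [h1, smul_dotProduct, dotProduct_comm]
    simp
  have h : (localWeight j φ v : ℂ) = ((∑ s, p s * ‖inner ℂ (b s) v‖ ^ 2 : ℝ) : ℂ) := by
    rw [localWeight_eq_inner, ← b.sum_inner_mul_inner]
    simp only [hH, Complex.ofReal_sum]
    refine Finset.sum_congr rfl fun s _ => ?_
    rw [← inner_conj_symm v, mul_left_comm, Complex.conj_mul']
    push_cast; ring
  exact_mod_cast h

theorem localWeight_eigenbasis (j : Fin k) (φ : Vec X)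
    (b : OrthonormalBasis (X j) ℂ (EuclideanSpace ℂ (X j))) (p : X j → ℝ)
    (hb : ∀ s, (localState j φ).mulVec (b s) = (p s : ℂ) • ⇑(b s)) (s : X j) :
    localWeight j φ (b s) = p s := by
  classical
  rw [localWeight_eq_sum j φ b p hb]
  rw [Finset.sum_eq_single s]
  · simp
  · intro t _ ht
    rw [b.orthonormal.2 ht]; simp
  · simp

end Local

/-! ### One-shot bounds -/

section OneShot

variable {k : ℕ} {X : Fin k → Type*} [∀ j, Fintype (X j)]

theorem slice_tensorVec (j : Fin k) (y : ∀ i : {i // i ≠ j}, X i)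
    (v : ∀ i, EuclideanSpace ℂ (X i)) :
    slice j y (tensorVec v) =
      tensorVec (fun i : {i // i ≠ j} => v i) y • v j := by
  ext s
  simp only [slice_apply, tensorVec, PiLp.smul_apply, smul_eq_mul]
  rw [Fintype.prod_eq_mul_prod_subtype_ne _ j, mul_comm]
  congr 1
  · refine Finset.prod_congr rfl fun i _ => ?_
    simp [Equiv.piSplitAt, i.2]
  · simp [Equiv.piSplitAt]

/-- The inner product with a product vector, evaluated by contracting the `j`-th factor first. -/
theorem inner_tensorVec_eq_inner_slice (j : Fin k) (v : ∀ i, EuclideanSpace ℂ (X i)) (φ : Vec X) :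
    inner ℂ (tensorVec v) φ = inner ℂ (tensorVec fun i : {i // i ≠ j} => v i)
      (WithLp.toLp 2 fun y => inner ℂ (v j) (slice j y φ)) := by
  have h : inner ℂ (tensorVec v) φ = ∑ y, inner ℂ (slice j y (tensorVec v)) (slice j y φ) := by
    simp only [PiLp.inner_apply, slice_apply]
    rw [Finset.sum_comm, ← Fintype.sum_prod_type' (f := fun s y =>
      inner ℂ ((tensorVec v) ((Equiv.piSplitAt j X).symm (s, y)))
        (φ ((Equiv.piSplitAt j X).symm (s, y))))]
    exact ((Equiv.piSplitAt j X).symm.sum_comp fun x => inner ℂ ((tensorVec v) x) (φ x)).symm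
  rw [h, PiLp.inner_apply]
  refine Finset.sum_congr rfl fun y _ => ?_
  rw [slice_tensorVec, inner_smul_left]
  simp [mul_comm]

/-- The distribution of the `j`-th coordinate when a vector is measured in a product basis. -/
theorem sum_norm_sq_inner_tensorBasis [∀ j, DecidableEq (X j)] (j : Fin k) (φ : Vec X)
    (b : ∀ i, OrthonormalBasis (X i) ℂ (EuclideanSpace ℂ (X i))) (s : X j) :
    ∑ x with x j = s, ‖inner ℂ (tensorBasis b x) φ‖ ^ 2 = localWeight j φ (b j s) := by
  have hsplit : ∀ f : (∀ i, X i) → ℝ,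
      ∑ x with x j = s, f x = ∑ y, f ((Equiv.piSplitAt j X).symm (s, y)) := by
    intro f
    rw [Finset.sum_filter, ← sum_slice j]
    refine Finset.sum_congr rfl fun y _ => ?_
    rw [Finset.sum_eq_single s]
    · simp [Equiv.piSplitAt]
    · intro t _ ht
      simp [Equiv.piSplitAt, ht]
    · simp
  rw [hsplit]
  have h := (tensorBasis fun i : {i // i ≠ j} => b i).sum_sq_norm_inner_right
    (WithLp.toLp 2 fun y => inner ℂ (b j s) (slice j y φ))
  rw [EuclideanSpace.norm_sq_eq] at h
  rw [localWeight]
  refine Eq.trans (Finset.sum_congr rfl fun y _ => ?_) h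
  rw [tensorBasis_apply, tensorBasis_apply, inner_tensorVec_eq_inner_slice j]
  have e1 : (fun i : {i // i ≠ j} => b i ((Equiv.piSplitAt j X).symm (s, y) i)) =
      fun i : {i // i ≠ j} => b i (y i) := by
    funext i
    simp [Equiv.piSplitAt, i.2]
  have e2 : (Equiv.piSplitAt j X).symm (s, y) j = s := by simp [Equiv.piSplitAt]
  simp only [e1, e2]

theorem rank_partialTrace_le (j : Fin k) (φ : Vec X) (b : X j → EuclideanSpace ℂ (X j))
    (T : Finset (X j)) (h : ∀ y, slice j y φ ∈ Submodule.span ℂ (b '' T)) :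
    (partialTrace j (pureState φ)).rank ≤ T.card := by
  classical
  rw [partialTrace_pureState]
  refine (Matrix.rank_mul_le_left _ _).trans ?_
  rw [Matrix.rank_transpose, Matrix.rank_eq_finrank_span_cols]
  have hle : Submodule.span ℂ (Set.range (bipartiteMatrix j φ).col) ≤
      (Submodule.span ℂ (b '' T)).map (WithLp.linearEquiv 2 ℂ (X j → ℂ)).toLinearMap := by
    rw [Submodule.span_le]
    rintro _ ⟨y, rfl⟩
    exact ⟨_, h y, rfl⟩
  refine (Submodule.finrank_mono hle).trans ((Submodule.finrank_map_le _ _).trans ?_)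
  rw [← Finset.coe_image]
  exact (finrank_span_finset_le_card _).trans Finset.card_image_le

theorem marginalRenyi_nonneg [∀ j, DecidableEq (X j)] {a : ℝ} (ha : a ≤ 1) (j : Fin k)
    {φ : Vec X} (hφ : ‖φ‖ = 1) : 0 ≤ marginalRenyi a j φ :=
  renyiEntropy_nonneg (eigenvalues_partialTrace_nonneg j φ)
    (sum_eigenvalues_partialTrace_eq_one j hφ) ha

theorem marginalEntropy_le_marginalRenyi [∀ j, DecidableEq (X j)] {a : ℝ} (ha : a ≤ 1) (j : Fin k)
    {φ : Vec X} (hφ : ‖φ‖ = 1) : marginalEntropy j φ ≤ marginalRenyi a j φ :=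
  shannonEntropy_le_renyiEntropy (eigenvalues_partialTrace_nonneg j φ)
    (sum_eigenvalues_partialTrace_eq_one j hφ) ha

theorem marginalRenyi_le_of_rank_le [∀ j, DecidableEq (X j)] {a : ℝ} (ha0 : 0 ≤ a) (ha : a ≤ 1)
    (j : Fin k) {φ : Vec X} (hφ : ‖φ‖ = 1) {R : ℝ}
    (h : ((partialTrace j (pureState φ)).rank : ℝ) ≤ 2 ^ R) : marginalRenyi a j φ ≤ R := by
  have hn := eigenvalues_partialTrace_nonneg j φ
  have h1 := sum_eigenvalues_partialTrace_eq_one j hφ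
  refine (renyiEntropy_le_renyiEntropy_zero hn h1 ha0 ha).trans ?_
  have hr : (partialTrace j (pureState φ)).rank = Nat.card {y // 0 <
      (isHermitian_partialTrace_pureState j φ).eigenvalues y} := by
    rw [(isHermitian_partialTrace_pureState j φ).rank_eq_card_non_zero_eigs,
      Nat.card_eq_fintype_card]
    exact Fintype.card_congr (Equiv.subtypeEquivRight fun y => (hn y).lt_iff_ne'.symm)
  have hpos : 0 < Nat.card {y // 0 < (isHermitian_partialTrace_pureState j φ).eigenvalues y} := by
    obtain ⟨y, -, hy⟩ := Finset.exists_ne_zero_of_sum_ne_zero (h1.trans_ne one_ne_zero)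
    have : Nonempty {y // 0 < (isHermitian_partialTrace_pureState j φ).eigenvalues y} :=
      ⟨y, (hn y).lt_of_ne' hy⟩
    exact Nat.card_pos
  rw [hr] at h
  rw [renyiEntropy, if_pos rfl]
  exact (Real.logb_le_iff_le_rpow one_lt_two (by exact_mod_cast hpos)).2 h

/-- Truncating a vector in a product basis to a box `∏ T j` gives a nearby vector all of whose
reduced states have rank at most `|T j|`. -/
theorem exists_vec_rank_le [∀ j, DecidableEq (X j)] (Ψ : Vec X) (hΨ : ‖Ψ‖ = 1)
    (b : ∀ i, OrthonormalBasis (X i) ℂ (EuclideanSpace ℂ (X i))) (T : ∀ j, Finset (X j)) {ε : ℝ}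
    (hε : ε < 1) (hT : ∑ j, ∑ s with s ∉ T j, localWeight j Ψ (b j s) ≤ ε) :
    ∃ φ : Vec X, ‖φ‖ = 1 ∧ 1 - ε ≤ ‖inner ℂ φ Ψ‖ ^ 2 ∧
      ∀ j, (partialTrace j (pureState φ)).rank ≤ (T j).card := by
  set B := tensorBasis b
  set c : (∀ j, X j) → ℂ := fun x => inner ℂ (B x) Ψ
  set A : Finset (∀ j, X j) := Fintype.piFinset T
  set N : ℝ := ∑ x ∈ A, ‖c x‖ ^ 2
  -- The union bound over the factors.
  have hN : 1 - ε ≤ N := by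
    have htot : ∑ x, ‖c x‖ ^ 2 = 1 := by rw [B.sum_sq_norm_inner_right, hΨ, one_pow]
    have hU : ∑ x ∈ Aᶜ, ‖c x‖ ^ 2 ≤ ∑ j, ∑ x with x j ∉ T j, ‖c x‖ ^ 2 := by
      simp only [Finset.sum_filter]
      rw [Finset.sum_comm]
      refine (Finset.sum_le_sum fun x hx => ?_).trans (Finset.sum_le_sum_of_subset_of_nonneg
        (Finset.subset_univ Aᶜ) fun x _ _ => Finset.sum_nonneg fun j _ => by positivity)
      obtain ⟨j, hj⟩ : ∃ j, x j ∉ T j := by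
        simpa [A, Fintype.mem_piFinset] using hx
      refine le_trans ?_ (Finset.single_le_sum (f := fun j => if x j ∉ T j then ‖c x‖ ^ 2 else 0)
        (fun j _ => by positivity) (Finset.mem_univ j))
      simp [hj]
    have hj : ∀ j, ∑ x with x j ∉ T j, ‖c x‖ ^ 2 = ∑ s with s ∉ T j, localWeight j Ψ (b j s) := by
      intro j
      simp only [← sum_norm_sq_inner_tensorBasis]
      rw [Finset.sum_filter, ← Finset.sum_fiberwise _ (fun x => x j), Finset.sum_filter]
      refine Finset.sum_congr rfl fun s _ => ?_
      by_cases hs : s ∈ T j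
      · rw [if_neg (not_not.2 hs)]
        refine Finset.sum_eq_zero fun x hx => ?_
        rw [(Finset.mem_filter.1 hx).2, if_neg (not_not.2 hs)]
      · rw [if_pos hs]
        refine Finset.sum_congr rfl fun x hx => ?_
        rw [(Finset.mem_filter.1 hx).2, if_pos hs]
    simp only [hj] at hU
    have := Finset.sum_add_sum_compl A fun x => ‖c x‖ ^ 2
    linarith
  have hNpos : 0 < N := by linarith
  set φ₀ : Vec X := ∑ x ∈ A, c x • B x
  have hin : inner ℂ φ₀ Ψ = (N : ℂ) := by
    simp only [φ₀, sum_inner, inner_smul_left, N, Complex.ofReal_sum]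
    exact Finset.sum_congr rfl fun x _ => by rw [Complex.conj_mul', Complex.ofReal_pow]
  have hnorm : ‖φ₀‖ ^ 2 = N := by
    have h : inner ℂ φ₀ φ₀ = (N : ℂ) := by
      simp only [φ₀]
      rw [B.orthonormal.inner_sum]
      simp only [N, Complex.ofReal_sum]
      exact Finset.sum_congr rfl fun x _ => by rw [Complex.conj_mul', Complex.ofReal_pow]
    rw [inner_self_eq_norm_sq_to_K] at h
    have h2 := congrArg Complex.re h
    simpa [← Complex.ofReal_pow] using h2
  have hn0 : ‖φ₀‖ ≠ 0 := fun h => by rw [h] at hnorm; simp at hnorm; linarith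
  refine ⟨((‖φ₀‖⁻¹ : ℝ) : ℂ) • φ₀, ?_, ?_, fun j => ?_⟩
  · rw [norm_smul, Complex.norm_real, norm_inv, norm_norm, inv_mul_cancel₀ hn0]
  · rw [inner_smul_left, hin, norm_mul, RCLike.norm_conj, Complex.norm_real, Complex.norm_real,
      mul_pow, norm_inv, norm_norm, inv_pow, hnorm, Real.norm_of_nonneg hNpos.le]
    field_simp
    exact hN
  · refine rank_partialTrace_le j _ (b j) (T j) fun y => ?_
    rw [map_smul, map_sum]
    refine Submodule.smul_mem _ _ (Submodule.sum_mem _ fun x hx => ?_)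
    rw [map_smul, show B x = _ from tensorBasis_apply b x, slice_tensorVec]
    exact Submodule.smul_mem _ _ (Submodule.smul_mem _ _ (Submodule.subset_span
      ⟨x j, Fintype.mem_piFinset.1 hx j, rfl⟩))

/-- A projection of rank at most `|G|` on the `j`-th factor captures at most `λ |G|` of the weight of
`Ψ`, up to the part of its spectrum above `λ`. -/
theorem sum_localWeight_le (j : Fin k) (Ψ : Vec X)
    (b v : OrthonormalBasis (X j) ℂ (EuclideanSpace ℂ (X j))) (p : X j → ℝ)
    (hp : ∀ s, 0 ≤ p s)
    (hb : ∀ s, (localState j Ψ).mulVec (b s) = (p s : ℂ) • ⇑(b s)) (G : Finset (X j)) {l : ℝ}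
    (hl : 0 ≤ l) :
    ∑ i ∈ G, localWeight j Ψ (v i) ≤ l * G.card + ∑ s with l < p s, p s := by
  have hterm : ∀ s i, p s * ‖inner ℂ (b s) (v i)‖ ^ 2 ≤ l * ‖inner ℂ (b s) (v i)‖ ^ 2 +
      (if l < p s then p s else 0) * ‖inner ℂ (b s) (v i)‖ ^ 2 := by
    intro s i
    rw [← add_mul]
    refine mul_le_mul_of_nonneg_right ?_ (sq_nonneg _)
    split_ifs with h <;> linarith
  calc ∑ i ∈ G, localWeight j Ψ (v i)
      = ∑ i ∈ G, ∑ s, p s * ‖inner ℂ (b s) (v i)‖ ^ 2 :=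
        Finset.sum_congr rfl fun i _ => localWeight_eq_sum j Ψ b p hb _
    _ ≤ ∑ i ∈ G, ∑ s, (l * ‖inner ℂ (b s) (v i)‖ ^ 2 +
          (if l < p s then p s else 0) * ‖inner ℂ (b s) (v i)‖ ^ 2) :=
        Finset.sum_le_sum fun i _ => Finset.sum_le_sum fun s _ => hterm s i
    _ = l * G.card + ∑ s, (if l < p s then p s else 0) * ∑ i ∈ G, ‖inner ℂ (b s) (v i)‖ ^ 2 := by
        simp only [Finset.sum_add_distrib, ← Finset.mul_sum, b.sum_sq_norm_inner_right,
          v.norm_eq_one]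
        rw [Finset.sum_comm]
        simp [Finset.mul_sum]
    _ ≤ l * G.card + ∑ s, (if l < p s then p s else 0) * 1 := by
        gcongr with s
        · split_ifs <;> simp [hp]
        · refine (Finset.sum_le_sum_of_subset_of_nonneg (Finset.subset_univ G) fun i _ _ =>
            sq_nonneg _).trans ?_
          rw [v.sum_sq_norm_inner_left, b.norm_eq_one, one_pow]
    _ = l * G.card + ∑ s with l < p s, p s := by simp [Finset.sum_filter]

/-- The local weights of nearby unit vectors are comparable. -/
theorem sum_localWeight_le_of_close (j : Fin k) {φ Ψ : Vec X} (hφ : ‖φ‖ = 1) (hΨ : ‖Ψ‖ = 1)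
    {ε : ℝ} (h : 1 - ε ≤ ‖inner ℂ φ Ψ‖ ^ 2)
    (v : OrthonormalBasis (X j) ℂ (EuclideanSpace ℂ (X j))) (G : Finset (X j)) :
    ∑ i ∈ G, localWeight j φ (v i) ≤ 2 * ∑ i ∈ G, localWeight j Ψ (v i) + 2 * ε := by
  -- Compare `φ` with its orthogonal projection `c • Ψ` onto the line spanned by `Ψ`.
  set c : ℂ := inner ℂ Ψ φ
  have hc : ‖c‖ = ‖inner ℂ φ Ψ‖ := norm_inner_symm _ _
  have hc1 : ‖c‖ ≤ 1 := by simpa [hφ, hΨ] using norm_inner_le_norm (𝕜 := ℂ) Ψ φ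
  have hdist : ‖φ - c • Ψ‖ ^ 2 ≤ ε := by
    have h1 := norm_sub_sq (𝕜 := ℂ) φ (c • Ψ)
    have h2 : RCLike.re (inner ℂ φ (c • Ψ)) = ‖c‖ ^ 2 := by
      rw [inner_smul_right, ← inner_conj_symm φ Ψ, Complex.mul_conj']
      norm_cast
    rw [h2, norm_smul, hφ, hΨ] at h1
    rw [← hc] at h
    linarith
  calc ∑ i ∈ G, localWeight j φ (v i)
      ≤ ∑ i ∈ G, (2 * localWeight j Ψ (v i) + 2 * localWeight j (φ - c • Ψ) (v i)) := by
        refine Finset.sum_le_sum fun i _ => ?_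
        have h1 := localWeight_add_le j (c • Ψ) (φ - c • Ψ) (v i)
        rw [add_sub_cancel, localWeight_smul] at h1
        have h2 : ‖c‖ ^ 2 * localWeight j Ψ (v i) ≤ localWeight j Ψ (v i) :=
          mul_le_of_le_one_left (localWeight_nonneg _ _ _) (pow_le_one₀ (norm_nonneg _) hc1)
        linarith
    _ ≤ 2 * ∑ i ∈ G, localWeight j Ψ (v i) + 2 * ∑ i, localWeight j (φ - c • Ψ) (v i) := by
        rw [Finset.sum_add_distrib, ← Finset.mul_sum, ← Finset.mul_sum]
        gcongr
        · exact fun i _ _ => localWeight_nonneg _ _ _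
        · exact Finset.subset_univ G
    _ ≤ 2 * ∑ i ∈ G, localWeight j Ψ (v i) + 2 * ε := by
        rw [sum_localWeight]
        gcongr

/-- If `φ` is close to `Ψ`, a small entropy of the reduced state of `φ` forces the reduced state of
`Ψ` to have large eigenvalues: the eigenvectors of the former with eigenvalue at least `2 ^ (-R)`
span a space of dimension at most `2 ^ R` which carries a definite part of the weight of `φ`, hence
also of `Ψ`. -/
theorem sub_marginalEntropy_le_of_close [∀ j, DecidableEq (X j)] (j : Fin k) {φ Ψ : Vec X}
    (hφ : ‖φ‖ = 1) (hΨ : ‖Ψ‖ = 1) {ε : ℝ} (h : 1 - ε ≤ ‖inner ℂ φ Ψ‖ ^ 2)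
    (b : OrthonormalBasis (X j) ℂ (EuclideanSpace ℂ (X j))) (p : X j → ℝ) (hp : ∀ s, 0 ≤ p s)
    (hb : ∀ s, (localState j Ψ).mulVec (b s) = (p s : ℂ) • ⇑(b s)) {R L : ℝ} (hR : 0 ≤ R) :
    R - marginalEntropy j φ ≤ R * (2 * (2 ^ (R - L) +
      ∑ s with (2 : ℝ) ^ (-L) < p s, p s) + 2 * ε) := by
  set hH := isHermitian_localState j φ
  have hn := eigenvalues_localState_nonneg j φ
  have h1 := sum_eigenvalues_localState j hφ
  set G : Finset (X j) := Finset.univ.filter fun s => (2 : ℝ) ^ (-R) ≤ hH.eigenvalues s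
  have hG : (G.card : ℝ) ≤ 2 ^ R :=
    card_le_of_forall_le hn h1 fun s hs => (Finset.mem_filter.1 hs).2
  have hM := sub_shannonEntropy_le hn h1 (R := R)
  rw [marginalEntropy_eq]
  refine hM.trans (mul_le_mul_of_nonneg_left ?_ hR)
  have hw : ∀ s, hH.eigenvalues s = localWeight j φ (hH.eigenvectorBasis s) := fun s =>
    (localWeight_eigenbasis j φ hH.eigenvectorBasis hH.eigenvalues
      (fun s => hH.mulVec_eigenvectorBasis s) s).symm
  have hS : ∑ s ∈ G, hH.eigenvalues s = ∑ s ∈ G, localWeight j φ (hH.eigenvectorBasis s) :=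
    Finset.sum_congr rfl fun s _ => hw s
  rw [hS]
  refine (sum_localWeight_le_of_close j hφ hΨ h hH.eigenvectorBasis G).trans ?_
  have hl : (0 : ℝ) ≤ 2 ^ (-L) := Real.rpow_nonneg two_pos.le _
  have h2 := sum_localWeight_le j Ψ b hH.eigenvectorBasis p hp hb G hl
  have h3 : (2 : ℝ) ^ (-L) * G.card ≤ 2 ^ (R - L) := by
    rw [sub_eq_neg_add, Real.rpow_add two_pos]
    exact mul_le_mul_of_nonneg_left hG hl
  linarith

end OneShot

/-! ### Tensor powers -/

section TensorPower

variable {k : ℕ} {X : Fin k → Type*} [∀ j, Fintype (X j)]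

theorem localState_apply (j : Fin k) (φ : Vec X) (s t : X j) :
    localState j φ s t = ∑ y, φ ((Equiv.piSplitAt j X).symm (s, y)) *
      star (φ ((Equiv.piSplitAt j X).symm (t, y))) := by
  simp [localState, Matrix.mul_apply, bipartiteMatrix, slice_apply]

theorem tensorPower_apply (ψ : Vec X) (n : ℕ) (x : ∀ j, Fin n → X j) :
    tensorPower ψ n x = ∏ t, ψ fun j => x j t := rfl

theorem norm_tensorPower {ψ : Vec X} (hψ : ‖ψ‖ = 1) (n : ℕ) : ‖tensorPower ψ n‖ = 1 := by
  have h : ‖tensorPower ψ n‖ ^ 2 = 1 := by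
    have h1 : (∑ x, ‖ψ x‖ ^ 2) ^ n = 1 := by
      rw [← EuclideanSpace.norm_sq_eq, hψ, one_pow, one_pow]
    rw [EuclideanSpace.norm_sq_eq, ← h1, Fintype.sum_pow,
      ← (Equiv.piComm fun (j : Fin k) (_ : Fin n) => X j).sum_comp]
    simp [tensorPower_apply, Finset.prod_pow, Equiv.piComm]
  exact (pow_eq_one_iff_of_nonneg (norm_nonneg _) two_ne_zero).1 h

/-- The reduced state of a tensor power is the tensor power of the reduced state. -/
theorem localState_tensorPower (j : Fin k) (ψ : Vec X) (n : ℕ) (s t : Fin n → X j) :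
    localState j (tensorPower ψ n) s t = ∏ r, localState j ψ (s r) (t r) := by
  have hsplit : ∀ (u : Fin n → X j) (y : ∀ i : {i // i ≠ j}, Fin n → X i) (r : Fin n),
      (fun i => (Equiv.piSplitAt j fun i => Fin n → X i).symm (u, y) i r) =
        (Equiv.piSplitAt j X).symm (u r, fun i => y i r) := by
    intro u y r
    funext i
    by_cases h : i = j
    · subst h; simp [Equiv.piSplitAt]
    · simp [Equiv.piSplitAt, h]
  simp only [localState_apply, tensorPower_apply, hsplit, star_prod, ← Finset.prod_mul_distrib]
  rw [Fintype.prod_sum,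
    ← (Equiv.piComm fun (i : {i // i ≠ j}) (_ : Fin n) => X i).sum_comp]
  rfl

/-- Product vectors formed from an eigenbasis of the reduced state of `ψ` are eigenvectors of the
reduced state of `ψ^{⊗n}`. -/
theorem localState_tensorPower_mulVec (j : Fin k) (ψ : Vec X)
    (b : OrthonormalBasis (X j) ℂ (EuclideanSpace ℂ (X j))) (p : X j → ℝ)
    (hb : ∀ s, (localState j ψ).mulVec (b s) = (p s : ℂ) • ⇑(b s)) (n : ℕ) (s : Fin n → X j) :
    (localState j (tensorPower ψ n)).mulVec (tensorBasis (fun _ : Fin n => b) s) =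
      ((∏ r, p (s r) : ℝ) : ℂ) • ⇑(tensorBasis (fun _ : Fin n => b) s) := by
  ext t
  have hb' : ∀ r, ∑ u, localState j ψ (t r) u * b (s r) u = p (s r) * b (s r) (t r) := fun r =>
    congrFun (hb (s r)) (t r)
  simp only [Matrix.mulVec, dotProduct, tensorBasis_apply, tensorVec, localState_tensorPower,
    ← Finset.prod_mul_distrib, Pi.smul_apply, smul_eq_mul, Complex.ofReal_prod]
  rw [← Fintype.prod_sum fun r u => localState j ψ (t r) u * b (s r) u]
  exact Finset.prod_congr rfl fun r _ => hb' r

theorem localState_tensorPower_mulVec_eigenvectorBasis [∀ j, DecidableEq (X j)] (j : Fin k)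
    (ψ : Vec X) (n : ℕ) (s : Fin n → X j) :
    (localState j (tensorPower ψ n)).mulVec
        (tensorBasis (fun _ : Fin n => (isHermitian_localState j ψ).eigenvectorBasis) s) =
      ((∏ r, (isHermitian_localState j ψ).eigenvalues (s r) : ℝ) : ℂ) •
        ⇑(tensorBasis (fun _ : Fin n => (isHermitian_localState j ψ).eigenvectorBasis) s) :=
  localState_tensorPower_mulVec j ψ _ _
    (fun s => (isHermitian_localState j ψ).mulVec_eigenvectorBasis s) n s

theorem localWeight_tensorPower [∀ j, DecidableEq (X j)] (j : Fin k) (ψ : Vec X) (n : ℕ)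
    (s : Fin n → X j) :
    localWeight j (tensorPower ψ n)
        (tensorBasis (fun _ : Fin n => (isHermitian_localState j ψ).eigenvectorBasis) s) =
      ∏ r, (isHermitian_localState j ψ).eigenvalues (s r) :=
  localWeight_eigenbasis (X := fun j => Fin n → X j) j (tensorPower ψ n)
    (tensorBasis fun _ : Fin n => (isHermitian_localState j ψ).eigenvectorBasis)
    (fun s => ∏ r, (isHermitian_localState j ψ).eigenvalues (s r))
    (localState_tensorPower_mulVec_eigenvectorBasis j ψ n) s

/-- Truncating `ψ^{⊗n}` to the typical eigenvectors of all its reduced states. -/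
theorem eventually_exists_vec [∀ j, DecidableEq (X j)] {ψ : Vec X} (hψ : ‖ψ‖ = 1) {ε δ : ℝ}
    (hε : 0 < ε) (hδ : 0 < δ) :
    ∀ᶠ n : ℕ in atTop, ∃ φ : Vec (fun j => Fin n → X j), ‖φ‖ = 1 ∧
      1 - ε ≤ ‖inner ℂ φ (tensorPower ψ n)‖ ^ 2 ∧
      ∀ j a, 0 ≤ a → a ≤ 1 → marginalRenyi a j φ ≤ n * (marginalEntropy j ψ + δ) := by
  set hH := fun j => isHermitian_localState j ψ
  set p : ∀ j, X j → ℝ := fun j => (hH j).eigenvalues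
  have hp : ∀ j s, 0 ≤ p j s := fun j => eigenvalues_localState_nonneg j ψ
  have hp1 : ∀ j, ∑ s, p j s = 1 := fun j => sum_eigenvalues_localState j hψ
  have ht := tendsto_finsetSum Finset.univ fun j _ => tendsto_sum_prod_of_small (hp j) (hp1 j) hδ
  rw [Finset.sum_const_zero] at ht
  filter_upwards [ht.eventually_le_const (lt_min hε one_half_pos)] with n hn
  let B : ∀ j, OrthonormalBasis (Fin n → X j) ℂ (EuclideanSpace ℂ (Fin n → X j)) := fun j =>
    tensorBasis fun _ => (hH j).eigenvectorBasis
  let T : ∀ j, Finset (Fin n → X j) := fun j => Finset.univ.filter fun x =>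
    (2 : ℝ) ^ (-(n * (shannonEntropy (p j) + δ))) < ∏ t, p j (x t)
  have hw : ∀ j s, localWeight j (tensorPower ψ n) (B j s) = ∏ t, p j (s t) := fun j s =>
    localWeight_tensorPower j ψ n s
  have hsum : ∑ j, ∑ s with s ∉ T j, localWeight j (tensorPower ψ n) (B j s) =
      ∑ j, ∑ x : Fin n → X j with
        ∏ t, p j (x t) ≤ (2 : ℝ) ^ (-(n * (shannonEntropy (p j) + δ))), ∏ t, p j (x t) :=
    Finset.sum_congr rfl fun j _ =>
      Finset.sum_congr (by ext s; simp [T]) fun s _ => hw j s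
  -- Truncation needs an error below `1`, so that the truncated vector is nonzero.
  obtain ⟨φ, h1, h2, h3⟩ := exists_vec_rank_le (tensorPower ψ n) (norm_tensorPower hψ n) B T
    (ε := min ε (1 / 2)) ((min_le_right _ _).trans_lt one_half_lt_one) 
    (hsum.trans_le hn)
  refine ⟨φ, h1, le_trans (by linarith [min_le_left ε (1 / 2)]) h2, fun j a ha0 ha1 => ?_⟩
  refine marginalRenyi_le_of_rank_le ha0 ha1 j h1 ?_
  have hc := card_le_of_forall_le (p := fun s : Fin n → X j => ∏ t, p j (s t))
    (fun s => Finset.prod_nonneg fun t _ => hp j _)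
    (by rw [← Fintype.sum_pow, hp1, one_pow]) (T := T j)
    fun s hs => (Finset.mem_filter.1 hs).2.le
  rw [marginalEntropy_eq]
  exact le_trans (by exact_mod_cast h3 j) hc

/-- Unit vectors close to `ψ^{⊗n}` have reduced states of entropy at least `n (H - δ)`. -/
theorem eventually_le_marginalEntropy [∀ j, DecidableEq (X j)] {ψ : Vec X} (hψ : ‖ψ‖ = 1) {δ : ℝ}
    (hδ : 0 < δ) (j : Fin k) :
    ∀ᶠ ε : ℝ in 𝓝[>] 0, ∀ᶠ n : ℕ in atTop, ∀ φ : Vec (fun j => Fin n → X j), ‖φ‖ = 1 →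
      1 - ε ≤ ‖inner ℂ φ (tensorPower ψ n)‖ ^ 2 →
      n * (marginalEntropy j ψ - δ) ≤ marginalEntropy j φ := by
  have hpos : ∀ n : ℕ, ∀ φ : Vec (fun j => Fin n → X j), ‖φ‖ = 1 → 0 ≤ marginalEntropy j φ :=
    fun n φ hφ => shannonEntropy_nonneg (eigenvalues_partialTrace_nonneg j φ)
      (sum_eigenvalues_partialTrace_eq_one j hφ)
  rcases le_or_gt (marginalEntropy j ψ - δ) 0 with hneg | hH0
  · exact Eventually.of_forall fun ε => Eventually.of_forall fun n φ hφ _ =>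
      (mul_nonpos_of_nonneg_of_nonpos n.cast_nonneg hneg).trans (hpos n φ hφ)
  set H := marginalEntropy j ψ
  -- An entropy of `n (H - δ)` or less would put a fraction `c` of the weight of `φ` on eigenvalues at
  -- least `2 ^ (-n (H - δ / 2))`, whereas the corresponding weight of `ψ^{⊗n}` tends to zero.
  set c : ℝ := (δ / 2) / (H - δ / 2) with hc
  have hHδ : 0 < H - δ / 2 := by linarith
  have hc0 : 0 < c := by positivity
  have hHer := isHermitian_localState j ψ
  set p : X j → ℝ := hHer.eigenvalues
  have hp : ∀ s, 0 ≤ p s := eigenvalues_localState_nonneg j ψ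
  have hp1 : ∑ s, p s = 1 := sum_eigenvalues_localState j hψ
  have hHp : H = shannonEntropy p := marginalEntropy_eq j ψ
  have ht1 := tendsto_sum_prod_of_large hp hp1 (δ := δ / 4) (by linarith)
  have ht2 : Tendsto (fun n : ℕ => ((2 : ℝ) ^ (-(δ / 4))) ^ n) atTop (𝓝 0) :=
    tendsto_pow_atTop_nhds_zero_of_lt_one (Real.rpow_nonneg two_pos.le _)
      (Real.rpow_lt_one_of_one_lt_of_neg one_lt_two (by linarith))
  have ht := ht2.add ht1
  rw [add_zero] at ht
  filter_upwards [Ioc_mem_nhdsGT (show (0 : ℝ) < c / 4 by linarith)] with ε hε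
  filter_upwards [ht.eventually_le_const (show (0 : ℝ) < c / 4 by linarith)] with n hn φ hφ hclose
  -- `L` lies strictly between `R` and `n H`: then both `2 ^ (R - L)` and the weight of the
  -- eigenvalues of `ψ^{⊗n}` above `2 ^ (-L)` vanish in the limit.
  have h := sub_marginalEntropy_le_of_close j hφ (norm_tensorPower hψ n) hclose
    (tensorBasis fun _ => hHer.eigenvectorBasis) (fun s => ∏ t, p (s t))
    (fun s => Finset.prod_nonneg fun t _ => hp _)
    (localState_tensorPower_mulVec_eigenvectorBasis j ψ n)
    (R := n * (H - δ / 2)) (L := n * (H - δ / 4)) (by positivity)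
  have e : (2 : ℝ) ^ (n * (H - δ / 2) - n * (H - δ / 4)) = ((2 : ℝ) ^ (-(δ / 4))) ^ n := by
    rw [← Real.rpow_natCast, ← Real.rpow_mul two_pos.le]
    congr 1; ring
  rw [← hHp] at hn
  rw [e] at h
  have h2 := h.trans (mul_le_mul_of_nonneg_left
    (show _ ≤ c by linarith [hε.2]) (by positivity : 0 ≤ n * (H - δ / 2)))
  have e2 : n * (H - δ / 2) * c = n * (δ / 2) := by
    rw [hc, mul_assoc, mul_div_cancel₀ _ hHδ.ne']
  rw [e2] at h2
  linarith

end TensorPower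

/-! ### The smoothed entropies -/

section Smoothing

variable {k : ℕ} {X : Fin k → Type*} [∀ j, Fintype (X j)] [∀ j, DecidableEq (X j)]

/-- Smoothing makes all the Rényi entropies of order in `[0, 1]` collapse to the von Neumann entropy
per copy. -/
theorem tendsto_limsup_smoothed {ψ : Vec X} (hψ : ‖ψ‖ = 1) {θ α : Fin k → ℝ}
    (hθ : ∀ j, 0 ≤ θ j) (hα : ∀ j, 0 ≤ α j ∧ α j ≤ 1) :
    Tendsto
      (fun ε : ℝ => limsup
        (fun n : ℕ => (((1 / (n : ℝ)) * smoothed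
          (fun φ => ∑ j, θ j * marginalRenyi (α j) j φ) ε (tensorPower ψ n) : ℝ) : EReal)) atTop)
      (𝓝[>] 0) (𝓝 ((∑ j, θ j * marginalEntropy j ψ : ℝ) : EReal)) := by
  set C := ∑ j, θ j * marginalEntropy j ψ with hC
  set Θ := ∑ j, θ j
  have hΘ : 0 ≤ Θ := Finset.sum_nonneg fun j _ => hθ j
  have hslack : ∀ n : ℕ, ∀ d : ℝ,
      ∑ j, θ j * (n * (marginalEntropy j ψ + d)) = n * (C + Θ * d) := by
    intro n d
    simp only [hC, Θ, Finset.sum_mul, ← Finset.sum_add_distrib, Finset.mul_sum]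
    exact Finset.sum_congr rfl fun j _ => by ring
  have hbound : ∀ r : ℝ, 0 < r → ∃ δ : ℝ, 0 < δ ∧ Θ * δ < r := fun r hr =>
    ⟨r / (Θ + 1), by positivity, by
      rw [← mul_div_assoc, div_lt_iff₀ (by linarith)]; nlinarith⟩
  rw [tendsto_order]
  constructor
  · intro a ha
    obtain ⟨r, har, hrC⟩ := EReal.lt_iff_exists_real_btwn.1 ha
    have hrC : r < C := EReal.coe_lt_coe_iff.1 hrC
    obtain ⟨δ, hδ, hδr⟩ := hbound (C - r) (by linarith)
    filter_upwards [eventually_all.2 (eventually_le_marginalEntropy hψ hδ), self_mem_nhdsWithin]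
      with ε hε hε0
    refine har.trans_le (le_limsup_of_frequently_le (Eventually.frequently ?_))
    filter_upwards [eventually_all.2 hε, eventually_gt_atTop 0] with n hn hn0
    have hn0' : (0 : ℝ) < n := by exact_mod_cast hn0
    rw [EReal.coe_le_coe_iff, one_div, ← div_eq_inv_mul, le_div_iff₀ hn0']
    refine le_csInf (Set.Nonempty.image _ ⟨tensorPower ψ n, norm_tensorPower hψ n, ?_⟩) ?_
    · rw [inner_self_eq_norm_sq_to_K, norm_tensorPower hψ n]
      simpa using le_of_lt hε0
    · rintro _ ⟨φ, ⟨hφ, hφε⟩, rfl⟩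
      refine le_trans ?_ (Finset.sum_le_sum fun j _ => mul_le_mul_of_nonneg_left
        ((hn j φ hφ hφε).trans (marginalEntropy_le_marginalRenyi (hα j).2 j hφ)) (hθ j))
      simp only [sub_eq_add_neg, hslack]
      nlinarith
  · intro a ha
    obtain ⟨r, hCr, hra⟩ := EReal.lt_iff_exists_real_btwn.1 ha
    have hCr : C < r := EReal.coe_lt_coe_iff.1 hCr
    obtain ⟨δ, hδ, hδr⟩ := hbound (r - C) (by linarith)
    filter_upwards [self_mem_nhdsWithin] with ε hε0
    refine lt_of_le_of_lt (limsup_le_of_le (h := ?_)) hra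
    filter_upwards [eventually_exists_vec hψ hε0 hδ, eventually_gt_atTop 0] with n hn hn0
    obtain ⟨φ, hφ, hφε, hφR⟩ := hn
    have hn0' : (0 : ℝ) < n := by exact_mod_cast hn0
    rw [EReal.coe_le_coe_iff, one_div, ← div_eq_inv_mul, div_le_iff₀ hn0']
    have hbdd : BddBelow ((fun φ : Vec (fun j => Fin n → X j) =>
        ∑ j, θ j * marginalRenyi (α j) j φ) ''
          {φ | ‖φ‖ = 1 ∧ 1 - ε ≤ ‖inner ℂ φ (tensorPower ψ n)‖ ^ 2}) := by
      refine ⟨0, ?_⟩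
      rintro _ ⟨χ, ⟨hχ, -⟩, rfl⟩
      exact Finset.sum_nonneg fun j _ =>
        mul_nonneg (hθ j) (marginalRenyi_nonneg (hα j).2 j hχ)
    refine (csInf_le hbdd ⟨φ, ⟨hφ, hφε⟩, rfl⟩).trans ?_
    refine (Finset.sum_le_sum fun j _ => mul_le_mul_of_nonneg_left
      (hφR j (α j) (hα j).1 (hα j).2) (hθ j)).trans ?_
    rw [hslack]
    nlinarith

end Smoothing
end MultipartiteAEP

theorem mainTheorem4 {k : ℕ} {X : Fin k → Type*} [∀ j, Fintype (X j)] [∀ j, DecidableEq (X j)]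
    (ψ : MultipartiteAEP.Vec X) (hψ : ‖ψ‖ = 1) :
    (∀ θ α : Fin k → ℝ, (∀ j, 0 ≤ θ j) → (∀ j, 0 ≤ α j ∧ α j ≤ 1) →
      Tendsto
        (fun ε : ℝ => limsup
          (fun n : ℕ => (((1 / (n : ℝ)) * MultipartiteAEP.smoothed
            (fun φ => ∑ j, θ j * MultipartiteAEP.marginalRenyi (α j) j φ) ε
            (MultipartiteAEP.tensorPower ψ n) : ℝ) : EReal)) atTop)
        (𝓝[>] 0)
        (𝓝 ((∑ j, θ j * MultipartiteAEP.marginalEntropy j ψ : ℝ) : EReal))) ∧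
    (∀ a : ℝ, 0 ≤ a → a ≤ 1 → ∀ j : Fin k,
      Tendsto
        (fun ε : ℝ => limsup
          (fun n : ℕ => (((1 / (n : ℝ)) * MultipartiteAEP.smoothed
            (fun φ => MultipartiteAEP.marginalRenyi a j φ) ε
            (MultipartiteAEP.tensorPower ψ n) : ℝ) : EReal)) atTop)
        (𝓝[>] 0)
        (𝓝 ((MultipartiteAEP.marginalEntropy j ψ : ℝ) : EReal))) := by
  refine ⟨fun θ α hθ hα => MultipartiteAEP.tendsto_limsup_smoothed hψ hθ hα,
    fun a ha0 ha1 j => ?_⟩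
  have h := MultipartiteAEP.tendsto_limsup_smoothed hψ (θ := Pi.single j 1) (α := fun _ => a)
    (fun i => by rw [Pi.single_apply]; split_ifs <;> norm_num) fun _ => ⟨ha0, ha1⟩
  simpa [Pi.single_apply] using h
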